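/- Let $(\Omega,\Sigma,\mu)$ be a $\sigma$-finite, non-atomic measure space with $\mu\neq 0$, and let $\varphi:[0,\infty)\to[0,\infty)$ be a finite Orlicz function, i.e. $\varphi$ is convex, (left-)continuous, $\varphi(0)=0$ and $\varphi$ is not identically zero. Let $L_\varphi=L_\varphi(\mu)$ be the Orlicz space of all (a.e. classes of) measurable $f:\Omega\to\mathbb R$ such that $I_\varphi(\lambda f):=\int_\Omega\varphi(\lambda|f|)\,d\mu<\infty$ for some $\lambda>0$, equipped with the Luxemburg norm $\|f\|_\varphi=\inf\{\epsilon>0: I_\varphi(f/\epsilon)\le 1\}$. A real normed space $X$ has the Daugavet property if $\|I+T\|=1+\|T\|$ for every bounded linear operator $T:X\to X$ of rank one. Then the following are equivalent: 1. $L_\varphi$ has the Daugavet property; 2. $\varphi$ is linear, i.e. there is $k>0$ with $\varphi(u)=ku$ for all $u\ge 0$; 3. there is $k>0$ such that $L_\varphi=L_1(\mu)$ as sets and $\|f\|_\varphi=k\|f\|_1$ for all $f\in L_\varphi$; 4. $L_\varphi$ is linearly isometric to $L_1(\mu)$. Moreover, if $\varphi(u)=ku$ for all $u\ge0$ with $k>0$,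 then $L_\varphi=L_1(\mu)$ as sets and $\|f\|_\varphi=k\|f\|_1$ for all $f\in L_\varphi$. -/

import Mathlib

open MeasureTheory
open scoped NNReal ENNReal

/-- An Orlicz function: a convex, left-continuous function `φ : [0, ∞) → [0, ∞]` with `φ 0 = 0`
which is neither identically `0` nor identically `∞` on `(0, ∞)`. -/
structure OrliczFunction where
  toFun : ℝ≥0 → ℝ≥0∞
  convexOn : ConvexOn ℝ≥0 Set.univ toFun
  map_zero : toFun 0 = 0
  leftContinuous : ∀ u : ℝ≥0, ContinuousWithinAt toFun (Set.Iic u) u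
  exists_ne_zero : ∃ u : ℝ≥0, 0 < u ∧ toFun u ≠ 0
  exists_ne_top : ∃ u : ℝ≥0, 0 < u ∧ toFun u ≠ ∞

namespace OrliczFunction

instance : CoeFun OrliczFunction (fun _ => ℝ≥0 → ℝ≥0∞) := ⟨toFun⟩

/-- `φ` does not take the value `∞`. -/
def IsFinite (φ : OrliczFunction) : Prop := ∀ u : ℝ≥0, φ u ≠ ∞

/-- `φ u = k u` for all `u ≥ 0`. -/
def IsLinearWith (φ : OrliczFunction) (k : ℝ≥0) : Prop := ∀ u : ℝ≥0, φ u = (k : ℝ≥0∞) * u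

/-- `φ u = k u` for all `u ≥ 0`, for some constant `k > 0`. -/
def IsLinear (φ : OrliczFunction) : Prop := ∃ k : ℝ≥0, 0 < k ∧ φ.IsLinearWith k

theorem map_mul_le (φ : OrliczFunction) {c : ℝ≥0} (hc : c ≤ 1) (u : ℝ≥0) :
    φ (c * u) ≤ (c : ℝ≥0∞) * φ u := by
  have h := φ.convexOn.2 (Set.mem_univ u) (Set.mem_univ 0) (zero_le : 0 ≤ c)
    (zero_le : 0 ≤ 1 - c) (add_tsub_cancel_of_le hc)
  simpa [φ.map_zero, ENNReal.smul_def] using h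

theorem mono (φ : OrliczFunction) : Monotone φ := by
  intro u v huv
  rcases eq_or_ne v 0 with rfl | hv
  · rw [le_antisymm huv zero_le]
  · have hc : u / v ≤ 1 := div_le_one_of_le₀ huv zero_le
    have h := φ.map_mul_le hc v
    rw [div_mul_cancel₀ _ hv] at h
    refine h.trans ?_
    calc ((u / v : ℝ≥0) : ℝ≥0∞) * φ v ≤ 1 * φ v := by
          gcongr
          exact_mod_cast hc
      _ = φ v := one_mul _

theorem measurable (φ : OrliczFunction) : Measurable φ := φ.mono.measurable

section Modular

variable {Ω : Type*} [MeasurableSpace Ω] {μ : Measure Ω}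

/-- The modular `I_φ(f) = ∫ φ(|f|) dμ`. -/
noncomputable def modular (φ : OrliczFunction) (f : Ω →ₘ[μ] ℝ) : ℝ≥0∞ :=
  ∫⁻ t, φ ‖f t‖₊ ∂μ

/-- The set `{ε > 0 : I_φ(f / ε) ≤ 1}`. -/
def luxemburgSet (φ : OrliczFunction) (f : Ω →ₘ[μ] ℝ) : Set ℝ :=
  {ε : ℝ | 0 < ε ∧ φ.modular (ε⁻¹ • f) ≤ 1}

/-- The Luxemburg norm `‖f‖_φ = inf {ε > 0 : I_φ(f / ε) ≤ 1}`. -/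
noncomputable def luxemburgNorm (φ : OrliczFunction) (f : Ω →ₘ[μ] ℝ) : ℝ :=
  sInf (φ.luxemburgSet f)

theorem modular_smul (φ : OrliczFunction) (c : ℝ) (f : Ω →ₘ[μ] ℝ) :
    φ.modular (c • f) = ∫⁻ t, φ (‖c‖₊ * ‖f t‖₊) ∂μ := by
  refine lintegral_congr_ae ?_
  filter_upwards [AEEqFun.coeFn_smul c f] with t ht
  simp [ht]

theorem aemeasurable_comp (φ : OrliczFunction) (c : ℝ≥0) (f : Ω →ₘ[μ] ℝ) :
    AEMeasurable (fun t => φ (c * ‖f t‖₊)) μ :=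
  φ.measurable.comp_aemeasurable (f.aestronglyMeasurable.aemeasurable.nnnorm.const_mul c)

theorem modular_smul_mono (φ : OrliczFunction) {c d : ℝ} (h : |c| ≤ |d|) (f : Ω →ₘ[μ] ℝ) :
    φ.modular (c • f) ≤ φ.modular (d • f) := by
  rw [modular_smul, modular_smul]
  refine lintegral_mono fun t => φ.mono ?_
  gcongr
  exact h

theorem modular_smul_le (φ : OrliczFunction) {c : ℝ≥0} (hc : c ≤ 1) (f : Ω →ₘ[μ] ℝ) :
    φ.modular ((c : ℝ) • f) ≤ c * φ.modular f := by
  rw [modular_smul, modular, ← lintegral_const_mul' _ _ ENNReal.coe_ne_top]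
  refine lintegral_mono fun t => ?_
  simpa using φ.map_mul_le hc ‖f t‖₊

theorem add_mem_luxemburgSet (φ : OrliczFunction) {f g : Ω →ₘ[μ] ℝ} {a b : ℝ}
    (ha : a ∈ φ.luxemburgSet f) (hb : b ∈ φ.luxemburgSet g) :
    a + b ∈ φ.luxemburgSet (f + g) := by
  obtain ⟨ha0, ha1⟩ := ha
  obtain ⟨hb0, hb1⟩ := hb
  refine ⟨by positivity, ?_⟩
  lift a to ℝ≥0 using ha0.le
  lift b to ℝ≥0 using hb0.le
  have ha0 : 0 < a := by exact_mod_cast ha0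
  have hb0 : 0 < b := by exact_mod_cast hb0
  have hab : a / (a + b) + b / (a + b) = 1 := by
    rw [← add_div, div_self (by positivity)]
  rw [modular_smul] at ha1 hb1 ⊢
  calc ∫⁻ t, φ (‖((a : ℝ) + b)⁻¹‖₊ * ‖(f + g) t‖₊) ∂μ
      ≤ ∫⁻ t, (((a / (a + b) : ℝ≥0) : ℝ≥0∞) * φ (‖(a : ℝ)⁻¹‖₊ * ‖f t‖₊)
          + ((b / (a + b) : ℝ≥0) : ℝ≥0∞) * φ (‖(b : ℝ)⁻¹‖₊ * ‖g t‖₊)) ∂μ := by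
        refine lintegral_mono_ae ?_
        filter_upwards [AEEqFun.coeFn_add f g] with t ht
        have h := φ.convexOn.2 (Set.mem_univ (‖(a : ℝ)⁻¹‖₊ * ‖f t‖₊))
          (Set.mem_univ (‖(b : ℝ)⁻¹‖₊ * ‖g t‖₊)) (zero_le : 0 ≤ a / (a + b))
          (zero_le : 0 ≤ b / (a + b)) hab
        simp only [ENNReal.smul_def, smul_eq_mul] at h
        refine le_trans (φ.mono ?_) h
        have e1 : ‖((a : ℝ) + b)⁻¹‖₊ = (a + b)⁻¹ := by
          rw [← NNReal.coe_add, nnnorm_inv, NNReal.nnnorm_eq]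
        rw [e1, nnnorm_inv, nnnorm_inv, NNReal.nnnorm_eq, NNReal.nnnorm_eq, ht]
        have e2 : a / (a + b) * (a⁻¹ * ‖f t‖₊) + b / (a + b) * (b⁻¹ * ‖g t‖₊)
            = (a + b)⁻¹ * (‖f t‖₊ + ‖g t‖₊) := by
          field_simp
        rw [e2]
        gcongr
        exact nnnorm_add_le _ _
    _ = ((a / (a + b) : ℝ≥0) : ℝ≥0∞) * ∫⁻ t, φ (‖(a : ℝ)⁻¹‖₊ * ‖f t‖₊) ∂μ
          + ((b / (a + b) : ℝ≥0) : ℝ≥0∞) * ∫⁻ t, φ (‖(b : ℝ)⁻¹‖₊ * ‖g t‖₊) ∂μ := by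
        rw [lintegral_add_left' ((φ.aemeasurable_comp _ f).const_mul _),
          lintegral_const_mul' _ _ ENNReal.coe_ne_top, lintegral_const_mul' _ _ ENNReal.coe_ne_top]
    _ ≤ ((a / (a + b) : ℝ≥0) : ℝ≥0∞) * 1 + ((b / (a + b) : ℝ≥0) : ℝ≥0∞) * 1 := by
        gcongr
    _ = 1 := by
        rw [mul_one, mul_one]
        exact_mod_cast hab

theorem smul_mem_luxemburgSet (φ : OrliczFunction) {f : Ω →ₘ[μ] ℝ} {a c : ℝ} (hc : c ≠ 0)
    (ha : a ∈ φ.luxemburgSet f) : |c| * a ∈ φ.luxemburgSet (c • f) := by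
  obtain ⟨ha0, ha1⟩ := ha
  refine ⟨by positivity, ?_⟩
  rw [smul_smul]
  refine (φ.modular_smul_mono (le_of_eq ?_) f).trans ha1
  rw [abs_mul, abs_inv, abs_mul, abs_abs, abs_inv]
  have : |c| ≠ 0 := by positivity
  field_simp

theorem mem_luxemburgSet_zero (φ : OrliczFunction) {a : ℝ} (ha : 0 < a) :
    a ∈ φ.luxemburgSet (0 : Ω →ₘ[μ] ℝ) := by
  refine ⟨ha, ?_⟩
  have h := φ.modular_smul_le (zero_le : (0 : ℝ≥0) ≤ 1) (0 : Ω →ₘ[μ] ℝ)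
  simp only [smul_zero, ENNReal.coe_zero, zero_mul] at h ⊢
  exact h.trans zero_le

theorem luxemburgSet_nonempty_iff (φ : OrliczFunction) (f : Ω →ₘ[μ] ℝ) :
    (φ.luxemburgSet f).Nonempty ↔ ∃ r : ℝ, 0 < r ∧ φ.modular (r • f) < ∞ := by
  constructor
  · rintro ⟨ε, h0, h1⟩
    exact ⟨ε⁻¹, by positivity, h1.trans_lt ENNReal.one_lt_top⟩
  · rintro ⟨r, hr, h⟩
    obtain ⟨M, hM⟩ : ∃ M : ℝ≥0, φ.modular (r • f) = M :=
      ⟨_, (ENNReal.coe_toNNReal h.ne).symm⟩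
    have hc1 : (M + 1)⁻¹ ≤ 1 := inv_le_one_of_one_le₀ le_add_self
    refine ⟨(((M + 1)⁻¹ : ℝ≥0) * r : ℝ)⁻¹, by positivity, ?_⟩
    rw [inv_inv, ← smul_smul]
    refine (φ.modular_smul_le hc1 _).trans ?_
    rw [hM]
    have : (M + 1)⁻¹ * M ≤ 1 := by
      rw [inv_mul_le_iff₀ (by positivity), mul_one]
      exact le_self_add
    exact_mod_cast this

theorem bddBelow_luxemburgSet (φ : OrliczFunction) (f : Ω →ₘ[μ] ℝ) :
    BddBelow (φ.luxemburgSet f) := ⟨0, fun _ h => h.1.le⟩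

theorem luxemburgNorm_nonneg (φ : OrliczFunction) (f : Ω →ₘ[μ] ℝ) : 0 ≤ φ.luxemburgNorm f :=
  Real.sInf_nonneg fun _ h => h.1.le

theorem luxemburgNorm_zero (φ : OrliczFunction) : φ.luxemburgNorm (0 : Ω →ₘ[μ] ℝ) = 0 := by
  refine le_antisymm (le_of_forall_pos_le_add fun ε hε => ?_) (φ.luxemburgNorm_nonneg _)
  rw [zero_add]
  exact csInf_le (φ.bddBelow_luxemburgSet _) (φ.mem_luxemburgSet_zero hε)

theorem luxemburgNorm_add_le (φ : OrliczFunction) {f g : Ω →ₘ[μ] ℝ}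
    (hf : (φ.luxemburgSet f).Nonempty) (hg : (φ.luxemburgSet g).Nonempty) :
    φ.luxemburgNorm (f + g) ≤ φ.luxemburgNorm f + φ.luxemburgNorm g := by
  refine le_of_forall_pos_le_add fun ε hε => ?_
  obtain ⟨a, ha, ha'⟩ := exists_lt_of_csInf_lt hf (lt_add_of_pos_right (sInf _) (half_pos hε))
  obtain ⟨b, hb, hb'⟩ := exists_lt_of_csInf_lt hg (lt_add_of_pos_right (sInf _) (half_pos hε))
  have h := csInf_le (φ.bddBelow_luxemburgSet _) (φ.add_mem_luxemburgSet ha hb)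
  simp only [luxemburgNorm]
  linarith

theorem luxemburgNorm_smul_le (φ : OrliczFunction) {c : ℝ} (hc : c ≠ 0) {f : Ω →ₘ[μ] ℝ}
    (hf : (φ.luxemburgSet f).Nonempty) :
    φ.luxemburgNorm (c • f) ≤ |c| * φ.luxemburgNorm f := by
  have hc' : 0 < |c| := abs_pos.2 hc
  rw [← div_le_iff₀' hc']
  refine le_csInf hf fun a ha => ?_
  rw [div_le_iff₀' hc']
  exact csInf_le (φ.bddBelow_luxemburgSet _) (φ.smul_mem_luxemburgSet hc ha)

theorem luxemburgNorm_smul (φ : OrliczFunction) (c : ℝ) {f : Ω →ₘ[μ] ℝ}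
    (hf : (φ.luxemburgSet f).Nonempty) :
    φ.luxemburgNorm (c • f) = |c| * φ.luxemburgNorm f := by
  rcases eq_or_ne c 0 with rfl | hc
  · simp [luxemburgNorm_zero]
  · refine le_antisymm (φ.luxemburgNorm_smul_le hc hf) ?_
    obtain ⟨a, ha⟩ := hf
    have h := φ.luxemburgNorm_smul_le (inv_ne_zero hc) ⟨_, φ.smul_mem_luxemburgSet hc ha⟩
    rw [smul_smul, inv_mul_cancel₀ hc, one_smul, abs_inv] at h
    rwa [← le_inv_mul_iff₀ (abs_pos.2 hc)]

theorem eq_zero_of_luxemburgNorm_eq_zero (φ : OrliczFunction) {f : Ω →ₘ[μ] ℝ}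
    (hf : (φ.luxemburgSet f).Nonempty) (h0 : φ.luxemburgNorm f = 0) : f = 0 := by
  have h1 : ∀ n : ℕ, φ.modular ((n : ℝ) • f) ≤ 1 := by
    intro n
    obtain ⟨a, ha, ha'⟩ := exists_lt_of_csInf_lt hf
      (show sInf (φ.luxemburgSet f) < ((n : ℝ) + 1)⁻¹ from h0.trans_lt (by positivity))
    refine (φ.modular_smul_mono ?_ f).trans ha.2
    have hlt := (lt_inv_comm₀ ha.1 (by positivity)).1 ha'
    rw [Nat.abs_cast, abs_of_pos (inv_pos.2 ha.1)]
    linarith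
  have h2 : ∀ n : ℕ, φ.modular ((n : ℝ) • f) = 0 := by
    intro n
    refine le_antisymm (ENNReal.le_of_forall_pos_le_add fun ε hε _ => ?_) zero_le
    obtain ⟨m, hm⟩ := exists_nat_gt (ε⁻¹)
    have hm0 : 0 < (m : ℝ≥0) := lt_of_le_of_lt zero_le hm
    have hle : ((m : ℝ≥0))⁻¹ ≤ ε := (inv_lt_comm₀ hε hm0).1 hm |>.le
    have hm1 : ((m : ℝ≥0))⁻¹ ≤ 1 := by
      have : 1 ≤ m := by exact_mod_cast hm0
      exact inv_le_one_of_one_le₀ (by exact_mod_cast this)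
    have h := φ.modular_smul_le hm1 (((m * n : ℕ) : ℝ) • f)
    rw [smul_smul] at h
    have e : (((m : ℝ≥0)⁻¹ : ℝ≥0) : ℝ) * ((m * n : ℕ) : ℝ) = n := by
      have : (m : ℝ) ≠ 0 := by exact_mod_cast hm0.ne'
      push_cast
      field_simp
    rw [e] at h
    rw [zero_add]
    refine h.trans (le_trans ?_ (ENNReal.coe_le_coe.2 hle))
    calc _ ≤ (((m : ℝ≥0)⁻¹ : ℝ≥0) : ℝ≥0∞) * 1 := by
          gcongr
          exact h1 _
      _ = _ := mul_one _
  have h3 : ∀ᵐ t ∂μ, ∀ n : ℕ, φ (‖(n : ℝ)‖₊ * ‖f t‖₊) = 0 := by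
    rw [ae_all_iff]
    intro n
    have := h2 n
    rw [modular_smul, lintegral_eq_zero_iff' (φ.aemeasurable_comp _ f)] at this
    exact this
  refine AEEqFun.ext ?_
  filter_upwards [h3, AEEqFun.coeFn_zero (α := Ω) (β := ℝ) (μ := μ)] with t ht h0
  rw [h0, Pi.zero_apply]
  by_contra hne
  obtain ⟨u, _, hu⟩ := φ.exists_ne_zero
  obtain ⟨n, hn⟩ := exists_nat_gt (u / ‖f t‖₊)
  have hpos : 0 < ‖f t‖₊ := nnnorm_pos.2 hne
  rw [div_lt_iff₀ hpos] at hn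
  have := φ.mono hn.le
  rw [show (n : ℝ≥0) = ‖(n : ℝ)‖₊ by simp, ht n] at this
  exact hu (le_antisymm this zero_le)

end Modular

end OrliczFunction

/-- The Orlicz space `L_φ(μ)`: all (classes modulo a.e. equality of) real measurable functions `f`
with `I_φ(r f) < ∞` for some `r > 0`. -/
def OrliczSpace {Ω : Type*} [MeasurableSpace Ω] (φ : OrliczFunction) (μ : Measure Ω) :
    Submodule ℝ (Ω →ₘ[μ] ℝ) where
  carrier := {f | ∃ r : ℝ, 0 < r ∧ φ.modular (r • f) < ∞}
  zero_mem' := (φ.luxemburgSet_nonempty_iff _).1 ⟨1, φ.mem_luxemburgSet_zero one_pos⟩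
  add_mem' := by
    intro f g hf hg
    obtain ⟨a, ha⟩ := (φ.luxemburgSet_nonempty_iff f).2 hf
    obtain ⟨b, hb⟩ := (φ.luxemburgSet_nonempty_iff g).2 hg
    exact (φ.luxemburgSet_nonempty_iff _).1 ⟨_, φ.add_mem_luxemburgSet ha hb⟩
  smul_mem' := by
    intro c f hf
    refine (φ.luxemburgSet_nonempty_iff _).1 ?_
    rcases eq_or_ne c 0 with rfl | hc
    · rw [zero_smul]
      exact ⟨1, φ.mem_luxemburgSet_zero one_pos⟩
    · obtain ⟨a, ha⟩ := (φ.luxemburgSet_nonempty_iff f).2 hf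
      exact ⟨_, φ.smul_mem_luxemburgSet hc ha⟩

namespace OrliczSpace

variable {Ω : Type*} [MeasurableSpace Ω] {φ : OrliczFunction} {μ : Measure Ω}

/-- `L_φ` is equipped with the Luxemburg norm. -/
noncomputable instance : Norm (OrliczSpace φ μ) := ⟨fun f => φ.luxemburgNorm (f : Ω →ₘ[μ] ℝ)⟩

theorem norm_def (f : OrliczSpace φ μ) : ‖f‖ = φ.luxemburgNorm (f : Ω →ₘ[μ] ℝ) := rfl

theorem luxemburgSet_nonempty (f : OrliczSpace φ μ) :
    (φ.luxemburgSet (f : Ω →ₘ[μ] ℝ)).Nonempty := (φ.luxemburgSet_nonempty_iff _).2 f.2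

theorem normedSpaceCore : NormedSpace.Core ℝ (OrliczSpace φ μ) where
  norm_nonneg f := φ.luxemburgNorm_nonneg _
  norm_smul c f := φ.luxemburgNorm_smul c (luxemburgSet_nonempty f)
  norm_triangle f g := φ.luxemburgNorm_add_le (luxemburgSet_nonempty f) (luxemburgSet_nonempty g)
  norm_eq_zero_iff f := by
    constructor
    · intro h
      exact Subtype.ext (φ.eq_zero_of_luxemburgNorm_eq_zero (luxemburgSet_nonempty f) h)
    · rintro rfl
      exact φ.luxemburgNorm_zero

noncomputable instance : NormedAddCommGroup (OrliczSpace φ μ) :=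
  NormedAddCommGroup.ofCore normedSpaceCore

noncomputable instance : NormedSpace ℝ (OrliczSpace φ μ) := NormedSpace.ofCore normedSpaceCore

end OrliczSpace

/-- `L_φ(μ) = L_1(μ)` as sets of functions and `‖f‖_φ = k ‖f‖_1` for all `f`. -/
def OrliczSpace.EqL1With {Ω : Type*} [MeasurableSpace Ω] (φ : OrliczFunction) (μ : Measure Ω)
    (k : ℝ) : Prop :=
  (∀ f : Ω →ₘ[μ] ℝ, f ∈ OrliczSpace φ μ ↔ f ∈ Lp ℝ 1 μ) ∧
    ∀ (f : OrliczSpace φ μ) (g : Lp ℝ 1 μ), (f : Ω →ₘ[μ] ℝ) = (g : Ω →ₘ[μ] ℝ) → ‖f‖ = k * ‖g‖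

/-- The Daugavet property of a real normed space `X`: every bounded linear operator `T : X → X` of
rank one satisfies `‖I + T‖ = 1 + ‖T‖`. -/
def DaugavetProperty (X : Type*) [NormedAddCommGroup X] [NormedSpace ℝ X] : Prop :=
  ∀ T : X →L[ℝ] X, Module.finrank ℝ (T : X →ₗ[ℝ] X).range = 1 →
    ‖ContinuousLinearMap.id ℝ X + T‖ = 1 + ‖T‖

/-- `μ` is non-atomic: every measurable set of positive measure has a measurable subset of positive
and strictly smaller measure. -/
def IsNonatomic {Ω : Type*} [MeasurableSpace Ω] (μ : Measure Ω) : Prop :=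
  ∀ s : Set Ω, MeasurableSet s → 0 < μ s → ∃ t ⊆ s, MeasurableSet t ∧ 0 < μ t ∧ μ t < μ s

/-! The circle is 1 → 2 → 3 → 4 → 1. If `φ` is linear with slope `k`, the modular is `k` times the
L¹ integral, which gives 3 and the final clause; multiplication by `k` then gives 4. The content
lies in 4 → 1 and 1 → 2.

For 4 → 1, the Daugavet property is an isometric invariant, so it is enough to treat L¹. A
functional `l` on L¹ of a non-atomic measure almost attains its norm at some `f` living where a
given unit vector `g` has little mass. Then `f` and `l f • g` are almost disjoint, their norms
almost add, and `I + l ⊗ g` has norm `1 + ‖l‖`.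

For 1 → 2, suppose `φ` is not linear. By convexity `φ (a/2) < φ a / 2` for all large `a`.
Non-atomicity and σ-finiteness give a set `A` of small measure `m`, hence a unit vector `x = a 1_A`
with `φ a = 1/m` and `a` that large. The strictness on `A`, integrated, yields some `r < 2` such
that every `y` in the open unit ball has `‖x + y‖ ≤ r` or `‖x - y‖ ≤ r`. With `p` a norming
functional of `x`, the operator `-p ⊗ x` then violates the Daugavet equation. -/

/-! ### Small supports in non-atomic measure spaces -/

/-- In a non-atomic measure space, every set of positive measure has a subset of positive measure
which is small for a given finite measure. -/
theorem IsNonatomic.exists_subset_measure_le {Ω : Type*} [MeasurableSpace Ω] {μ : Measure Ω}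
    (hμ : IsNonatomic μ) (ν : Measure Ω) [IsFiniteMeasure ν] {s : Set Ω} (hs : MeasurableSet s)
    (hs0 : 0 < μ s) {ε : ℝ} (hε : 0 < ε) :
    ∃ t ⊆ s, MeasurableSet t ∧ 0 < μ t ∧ ν.real t ≤ ε := by
  have key : ∀ n : ℕ, ∃ t ⊆ s, MeasurableSet t ∧ 0 < μ t ∧ ν.real t ≤ ν.real s * (1 / 2) ^ n := by
    intro n
    induction n with
    | zero => exact ⟨s, subset_rfl, hs, hs0, by simp⟩
    | succ n ih =>
      obtain ⟨t, hts, ht, ht0, htν⟩ := ih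
      obtain ⟨u, hut, hu, hu0, hlt⟩ := hμ t ht ht0
      have hd : 0 < μ (t \ u) := by
        refine (tsub_pos_of_lt hlt).trans_le le_measure_sdiff
      have hadd : ν.real t = ν.real u + ν.real (t \ u) := by
        rw [measureReal_sdiff hut hu]; ring
      rw [pow_succ]
      -- Both pieces have positive `μ`-measure; the one of smaller `ν`-measure carries at most half
      -- of `ν t`.
      rcases le_total (ν.real u) (ν.real (t \ u)) with h | h
      · exact ⟨u, hut.trans hts, hu, hu0, by linarith⟩
      · exact ⟨t \ u, Set.sdiff_subset.trans hts, ht.diff hu, hd, by linarith⟩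
  obtain ⟨n, hn⟩ := exists_pow_lt_of_lt_one (show 0 < ε / (ν.real s + 1) by positivity)
    (show (1 / 2 : ℝ) < 1 by norm_num)
  obtain ⟨t, hts, ht, ht0, htν⟩ := key n
  refine ⟨t, hts, ht, ht0, htν.trans ?_⟩
  rw [lt_div_iff₀ (by positivity)] at hn
  have : (0 : ℝ) ≤ (1 / 2) ^ n := by positivity
  linarith

/-- A bounded functional on `L¹` of a non-atomic measure nearly attains its norm at functions
whose support is small for a given finite measure. -/
theorem IsNonatomic.exists_lp_one_small_support {Ω : Type*} [MeasurableSpace Ω] {μ : Measure Ω}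
    (hμ : IsNonatomic μ) (ν : Measure Ω) [IsFiniteMeasure ν] (l : Lp ℝ 1 μ →L[ℝ] ℝ) {c : ℝ}
    (hc0 : 0 ≤ c) (hc : c < ‖l‖) {ε : ℝ} (hε : 0 < ε) :
    ∃ (t : Set Ω) (f : Lp ℝ 1 μ), MeasurableSet t ∧ ν.real t ≤ ε ∧ f ≠ 0 ∧
      (∀ᵐ x ∂μ, x ∉ t → f x = 0) ∧ c * ‖f‖ ≤ l f := by
  obtain ⟨f, hf⟩ : ∃ f, c * ‖f‖ < l f := by
    by_contra! h
    refine hc.not_ge (l.opNorm_le_bound hc0 fun f => ?_)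
    rw [Real.norm_eq_abs, abs_le]
    have h1 := h f
    have h2 := h (-f)
    rw [map_neg, norm_neg] at h2
    constructor <;> linarith
  have hfi : Integrable f μ := L1.integrable_coeFn f
  have hi : ∀ s : Set Ω, MeasurableSet s → Integrable (s.indicator f) μ :=
    fun s hs => hfi.indicator hs
  classical
  -- The defect of the desired inequality for `f` cut down to `s`. It is additive because the L¹
  -- norm is additive over disjoint supports, and it is negative on the whole space.
  set m : Set Ω → ℝ := fun s => if hs : MeasurableSet s then
    c * ‖(hi s hs).toL1 _‖ - l ((hi s hs).toL1 _) else 0 with hm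
  have hnorm : ∀ s (hs : MeasurableSet s), ‖(hi s hs).toL1 _‖ = ∫ x in s, ‖f x‖ ∂μ := by
    intro s hs
    rw [L1.norm_eq_integral_norm, ← integral_indicator hs]
    refine integral_congr_ae ?_
    filter_upwards [(hi s hs).coeFn_toL1] with x hx
    rw [hx, norm_indicator_eq_indicator_norm]
  -- Domination by this finite measure upgrades finite additivity of `m` to countable additivity.
  set ρ : Measure Ω := ENNReal.ofReal (c + ‖l‖) • μ.withDensity (fun x => ‖f x‖ₑ) with hρ
  have hfin : IsFiniteMeasure (μ.withDensity (fun x => ‖f x‖ₑ)) :=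
    isFiniteMeasure_withDensity hfi.2.ne
  have : IsFiniteMeasure ρ := by
    rw [hρ]
    exact Measure.smul_finite _ ENNReal.ofReal_ne_top
  have hbound : ∀ s, ‖m s‖ₑ ≤ ρ s := by
    intro s
    by_cases hs : MeasurableSet s
    · rw [hρ, Measure.smul_apply, withDensity_apply _ hs, smul_eq_mul,
        ← ofReal_integral_norm_eq_lintegral_enorm hfi.restrict, ← hnorm s hs,
        ← ENNReal.ofReal_mul (by positivity), ← ofReal_norm]
      refine ENNReal.ofReal_le_ofReal ?_
      simp only [hm, dif_pos hs]
      refine (norm_sub_le _ _).trans ?_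
      rw [norm_mul, norm_norm, Real.norm_of_nonneg hc0, add_mul]
      gcongr
      exact l.le_opNorm _
    · simp [hm, hs]
  have hadd : ∀ s t, MeasurableSet s → MeasurableSet t → Disjoint s t →
      m (s ∪ t) = m s + m t := by
    intro s t hs ht hst
    have e : (hi _ (hs.union ht)).toL1 _ = (hi s hs).toL1 _ + (hi t ht).toL1 _ := by
      rw [← Integrable.toL1_add]
      exact (Integrable.toL1_eq_toL1_iff _ _ _ _).2
        (Filter.Eventually.of_forall fun x => congrFun (Set.indicator_union_of_disjoint hst f) x)
    simp only [hm, dif_pos hs, dif_pos ht, dif_pos (hs.union ht)]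
    rw [hnorm _ hs, hnorm _ ht, hnorm _ (hs.union ht), e, map_add,
      setIntegral_union hst ht hfi.norm.integrableOn hfi.norm.integrableOn]
    ring
  let M : SignedMeasure Ω := VectorMeasure.of_additive_of_le_measure m hbound hadd
    (fun s hs => by simp [hm, hs])
  have hM : ∀ s (hs : MeasurableSet s),
      M s = c * ‖(hi s hs).toL1 _‖ - l ((hi s hs).toL1 _) := by
    intro s hs
    change m s = _
    simp only [hm, dif_pos hs]
  have hMu : M Set.univ < 0 := by
    rw [hM _ MeasurableSet.univ]
    have e : (hi _ MeasurableSet.univ).toL1 _ = f := by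
      refine Lp.ext ?_
      filter_upwards [(hi _ MeasurableSet.univ).coeFn_toL1] with x hx
      rw [hx, Set.indicator_univ]
    rw [e]
    linarith
  -- On `P` the inequality holds for the restriction of `f` to every measurable subset, so the
  -- support may be shrunk freely.
  obtain ⟨P, hP, -, hPneg, hP0⟩ := SignedMeasure.exists_subset_restrict_nonpos hMu
  have hmeas : Measurable f := (Lp.stronglyMeasurable f).measurable
  -- Discarding the zeros of `f` keeps restrictions nonzero; `Q` is not null, since otherwise `f`
  -- vanishes a.e. on `P` and `M P = 0`.
  set Q := P ∩ {x | f x ≠ 0} with hQ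
  have hQm : MeasurableSet Q := hP.inter (hmeas (measurableSet_singleton 0).compl)
  have hQ0 : 0 < μ Q := by
    rw [pos_iff_ne_zero]
    intro h0
    have e : (hi P hP).toL1 _ = 0 := by
      refine Lp.ext ?_
      filter_upwards [(hi P hP).coeFn_toL1, measure_eq_zero_iff_ae_notMem.1 h0,
        Lp.coeFn_zero ℝ 1 μ] with x hx hxQ hx0
      rw [hx, hx0, Pi.zero_apply, Set.indicator_apply_eq_zero]
      intro hxP
      by_contra hne
      exact hxQ ⟨hxP, hne⟩
    rw [hM P hP, e] at hP0
    simp at hP0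
  obtain ⟨t, htQ, ht, ht0, htν⟩ := hμ.exists_subset_measure_le ν hQm hQ0 hε
  refine ⟨t, (hi t ht).toL1 _, ht, htν, ?_, ?_, ?_⟩
  · intro h0
    refine ht0.ne' (measure_eq_zero_iff_ae_notMem.2 ?_)
    have h1 := (hi t ht).coeFn_toL1
    rw [h0] at h1
    filter_upwards [h1, Lp.coeFn_zero ℝ 1 μ] with x hx hx0 hxt
    rw [hx0, Set.indicator_of_mem hxt] at hx
    exact (htQ hxt).2 hx.symm
  · filter_upwards [(hi t ht).coeFn_toL1] with x hx hxt
    rw [hx, Set.indicator_of_notMem hxt]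
  · have := VectorMeasure.subset_le_of_restrict_le_restrict M 0 hP hPneg
      (htQ.trans Set.inter_subset_left)
    rw [hM t ht] at this
    simpa using this

/-! ### The Daugavet property of L¹ -/

theorem ContinuousLinearMap.exists_eq_smulRight_of_finrank_range_eq_one {X : Type*}
    [NormedAddCommGroup X] [NormedSpace ℝ X] (T : X →L[ℝ] X)
    (hT : Module.finrank ℝ (T : X →ₗ[ℝ] X).range = 1) :
    ∃ (l : X →L[ℝ] ℝ) (g : X), ‖g‖ = 1 ∧ T = l.smulRight g := by
  obtain ⟨⟨v, hv⟩, hv0, hspan⟩ := finrank_eq_one_iff'.1 hT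
  have hv0 : v ≠ 0 := fun h => hv0 (Subtype.ext h)
  have hvn : ‖v‖ ≠ 0 := norm_ne_zero_iff.2 hv0
  obtain ⟨p, -, hp⟩ := exists_dual_vector ℝ v hvn
  refine ⟨p.comp T, ‖v‖⁻¹ • v, ?_, ?_⟩
  · rw [norm_smul, norm_inv, norm_norm, inv_mul_cancel₀ hvn]
  · ext x
    obtain ⟨c, hc⟩ := hspan ⟨T x, ⟨x, rfl⟩⟩
    have hc' : c • v = T x := congrArg Subtype.val hc
    rw [ContinuousLinearMap.smulRight_apply, ContinuousLinearMap.comp_apply, ← hc', map_smul, hp,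
      smul_smul]
    congr 1
    simp [hvn]

/-- `L¹` of a non-atomic measure has the Daugavet property. -/
theorem IsNonatomic.daugavetProperty_lp_one {Ω : Type*} [MeasurableSpace Ω] {μ : Measure Ω}
    (hμ : IsNonatomic μ) : DaugavetProperty (Lp ℝ 1 μ) := by
  intro T hT
  obtain ⟨l, g, hg, rfl⟩ := T.exists_eq_smulRight_of_finrank_range_eq_one hT
  have hnT : ‖l.smulRight g‖ = ‖l‖ := by rw [ContinuousLinearMap.norm_smulRight_apply, hg, mul_one]
  refine le_antisymm ((norm_add_le _ _).trans ?_) ?_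
  · gcongr
    exact ContinuousLinearMap.norm_id_le
  rw [hnT]
  set S := ContinuousLinearMap.id ℝ (Lp ℝ 1 μ) + l.smulRight g with hS
  have hl : 0 < ‖l‖ := by
    rw [norm_pos_iff]
    rintro rfl
    rw [show (0 : Lp ℝ 1 μ →L[ℝ] ℝ).smulRight g = 0 by ext1 x; simp,
      ContinuousLinearMap.toLinearMap_zero, LinearMap.range_zero, finrank_bot] at hT
    exact zero_ne_one hT
  have hgi : Integrable g μ := L1.integrable_coeFn g
  have : IsFiniteMeasure (μ.withDensity (fun x => ‖g x‖ₑ)) :=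
    isFiniteMeasure_withDensity hgi.2.ne
  have key : ∀ c, 0 ≤ c → c < ‖l‖ → ∀ ε, 0 < ε → ε < 1 / 2 → 1 + c * (1 - 2 * ε) ≤ ‖S‖ := by
    intro c hc0 hc ε hε hε2
    obtain ⟨t, f, ht, hts, hf0, hft, hlf⟩ :=
      hμ.exists_lp_one_small_support (μ.withDensity (fun x => ‖g x‖ₑ)) l hc0 hc hε
    have hfi : Integrable f μ := L1.integrable_coeFn f
    have hfpos : 0 < ‖f‖ := norm_pos_iff.2 hf0
    have hlf0 : 0 ≤ l f := le_trans (by positivity) hlf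
    have hgt : ∫ x in t, ‖g x‖ ∂μ ≤ ε := by
      rw [Measure.real, withDensity_apply _ ht] at hts
      rwa [integral_norm_eq_lintegral_enorm hgi.restrict.aestronglyMeasurable]
    -- Pointwise, `|f + l f g|` is at least `|f| - l f |g|` on `t` and equals `l f |g|` off `t`,
    -- where `f = 0`; the mass of `g` on `t` is thus lost twice.
    have hlow : ‖f‖ + l f * (1 - 2 * ∫ x in t, ‖g x‖ ∂μ) ≤ ‖S f‖ := by
      have e1 : ‖f‖ + l f * (1 - 2 * ∫ x in t, ‖g x‖ ∂μ)
          = ∫ x, (‖f x‖ + l f * (‖g x‖ - 2 * t.indicator (fun x => ‖g x‖) x)) ∂μ := by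
        have hsub : Integrable (fun x => ‖g x‖ - 2 * t.indicator (fun x => ‖g x‖) x) μ :=
          hgi.norm.sub ((hgi.norm.indicator ht).const_mul 2)
        rw [integral_add hfi.norm (hsub.const_mul _), integral_const_mul, integral_sub hgi.norm ((hgi.norm.indicator ht).const_mul 2),
          integral_const_mul, integral_indicator ht, ← L1.norm_eq_integral_norm,
          ← L1.norm_eq_integral_norm, hg]
      rw [e1, L1.norm_eq_integral_norm]
      refine integral_mono_ae (hfi.norm.add
        ((hgi.norm.sub ((hgi.norm.indicator ht).const_mul 2)).const_mul _))
        (L1.integrable_coeFn _).norm ?_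
      have eS : S f = f + l f • g := rfl
      rw [eS]
      filter_upwards [Lp.coeFn_add f (l f • g), Lp.coeFn_smul (l f) g, hft] with x h1 h2 h3
      simp only [h1, Pi.add_apply, h2, Pi.smul_apply, smul_eq_mul]
      by_cases hx : x ∈ t
      · rw [Set.indicator_of_mem hx]
        have := norm_sub_norm_le (f x) (-(l f * g x))
        rw [norm_neg, norm_mul, Real.norm_of_nonneg hlf0, sub_neg_eq_add] at this
        linarith
      · rw [Set.indicator_of_notMem hx, h3 hx, norm_zero, zero_add, zero_add, norm_mul,
          Real.norm_of_nonneg hlf0, mul_zero, sub_zero]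
    have hup := S.le_opNorm f
    have h1 : c * ‖f‖ * (1 - 2 * ε) ≤ l f * (1 - 2 * ∫ x in t, ‖g x‖ ∂μ) :=
      mul_le_mul hlf (by linarith) (by linarith) hlf0
    refine le_of_mul_le_mul_right ?_ hfpos
    linarith
  have key2 : ∀ c, 0 ≤ c → c < ‖l‖ → 1 + c ≤ ‖S‖ := by
    intro c hc0 hc
    refine le_of_forall_pos_le_add fun η hη => ?_
    -- The value of `ε` makes the loss `2 c ε` at most `η`; the cap `1/4` secures `ε < 1/2`.
    have h := key c hc0 hc (min (1 / 4) (η / (2 * (c + 1)))) (by positivity)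
      ((min_le_left _ _).trans_lt (by norm_num))
    have h2 : c * (2 * min (1 / 4) (η / (2 * (c + 1)))) ≤ η := by
      calc c * (2 * min (1 / 4) (η / (2 * (c + 1)))) ≤ (c + 1) * (2 * (η / (2 * (c + 1)))) := by
            gcongr
            · linarith
            · exact min_le_right _ _
        _ = η := by field_simp
    linarith
  refine le_of_forall_pos_le_add fun η hη => ?_
  rcases le_total ‖l‖ η with h | h
  · have := key2 0 le_rfl hl
    linarith
  · have := key2 (‖l‖ - η) (by linarith) (by linarith)
    linarith

/-- Conjugation by `e` preserves the identity, operator norms and rank. -/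
theorem DaugavetProperty.of_linearIsometryEquiv {X Y : Type*} [NormedAddCommGroup X]
    [NormedSpace ℝ X] [NormedAddCommGroup Y] [NormedSpace ℝ Y] (e : X ≃ₗᵢ[ℝ] Y)
    (hY : DaugavetProperty Y) : DaugavetProperty X := by
  intro T hT
  set F : X ≃L[ℝ] Y := e.toContinuousLinearEquiv with hF
  have hn : ∀ A : X →L[ℝ] X, ‖(F : X →L[ℝ] Y) ∘L A ∘L (F.symm : Y →L[ℝ] X)‖ = ‖A‖ := by
    intro A
    refine le_antisymm (ContinuousLinearMap.opNorm_le_bound _ (norm_nonneg _) fun y => ?_)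
      (ContinuousLinearMap.opNorm_le_bound _ (norm_nonneg _) fun x => ?_)
    · calc ‖e (A (e.symm y))‖ = ‖A (e.symm y)‖ := e.norm_map _
        _ ≤ ‖A‖ * ‖e.symm y‖ := A.le_opNorm _
        _ = _ := by rw [e.symm.norm_map]
    · have h := ((F : X →L[ℝ] Y) ∘L A ∘L (F.symm : Y →L[ℝ] X)).le_opNorm (e x)
      have h1 : ((F : X →L[ℝ] Y) ∘L A ∘L (F.symm : Y →L[ℝ] X)) (e x) = e (A x) := by
        change e (A (e.symm (e x))) = _
        rw [e.symm_apply_apply]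
      rwa [h1, e.norm_map, e.norm_map] at h
  have h := hY ((F : X →L[ℝ] Y) ∘L T ∘L (F.symm : Y →L[ℝ] X)) ?_
  · rw [hn] at h
    rw [← h, ← hn]
    congr 1
    ext1 y
    simp
  · rw [← hT]
    have hr : (((F : X →L[ℝ] Y) ∘L T ∘L (F.symm : Y →L[ℝ] X) : Y →L[ℝ] Y) : Y →ₗ[ℝ] Y).range
        = (T : X →ₗ[ℝ] X).range.map (e.toLinearEquiv : X →ₗ[ℝ] Y) := by
      ext y
      constructor
      · rintro ⟨z, rfl⟩
        exact ⟨T (e.symm z), ⟨e.symm z, rfl⟩, rfl⟩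
      · rintro ⟨_, ⟨x, rfl⟩, rfl⟩
        refine ⟨e x, ?_⟩
        change e (T (e.symm (e x))) = e (T x)
        rw [e.symm_apply_apply]
    rw [hr]
    exact LinearEquiv.finrank_map_eq e.toLinearEquiv _

/-! ### Linear Orlicz functions and L¹ -/

namespace OrliczFunction

theorem IsLinearWith.modular_smul {Ω : Type*} [MeasurableSpace Ω] {μ : Measure Ω}
    {φ : OrliczFunction} {k : ℝ≥0} (h : φ.IsLinearWith k) (c : ℝ) (f : Ω →ₘ[μ] ℝ) :
    φ.modular (c • f) = k * (‖c‖ₑ * ∫⁻ t, ‖f t‖ₑ ∂μ) := by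
  rw [φ.modular_smul, ← lintegral_const_mul' _ _ (by simp),
    ← lintegral_const_mul' _ _ ENNReal.coe_ne_top]
  refine lintegral_congr fun t => ?_
  rw [h, ENNReal.coe_mul]
  rfl

/-- The Orlicz space of a linear function is `L¹` with a multiple of the `L¹` norm. -/
theorem IsLinearWith.eqL1With {Ω : Type*} [MeasurableSpace Ω] {μ : Measure Ω}
    {φ : OrliczFunction} {k : ℝ≥0} (hk : 0 < k) (h : φ.IsLinearWith k) :
    OrliczSpace.EqL1With φ μ k := by
  refine ⟨fun f => ?_, fun f g hfg => ?_⟩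
  · rw [Lp.mem_Lp_iff_eLpNorm_lt_top, eLpNorm_one_eq_lintegral_enorm]
    change (∃ r : ℝ, 0 < r ∧ φ.modular (r • f) < ∞) ↔ _
    constructor
    · rintro ⟨r, hr, hlt⟩
      rw [h.modular_smul] at hlt
      have h1 := ENNReal.lt_top_of_mul_ne_top_right hlt.ne (by simpa using hk.ne')
      exact ENNReal.lt_top_of_mul_ne_top_right h1.ne (by simpa using hr.ne')
    · intro hlt
      refine ⟨1, one_pos, ?_⟩
      rw [h.modular_smul]
      exact ENNReal.mul_lt_top ENNReal.coe_lt_top (ENNReal.mul_lt_top (by simp) hlt)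
  · have hmem : ∀ ε : ℝ, ε ∈ φ.luxemburgSet (f : Ω →ₘ[μ] ℝ) ↔ 0 < ε ∧ k * ‖g‖ ≤ ε := by
      intro ε
      refine and_congr_right fun hε => ?_
      have hg : ∫⁻ t, ‖(g : Ω →ₘ[μ] ℝ) t‖ₑ ∂μ = ENNReal.ofReal ‖g‖ := by
        rw [L1.norm_def, ENNReal.ofReal_toReal (L1.integrable_coeFn g).2.ne]
      rw [h.modular_smul, hfg, hg, ← ofReal_norm, ← ENNReal.ofReal_mul (norm_nonneg _),
        ← ENNReal.ofReal_coe_nnreal, ← ENNReal.ofReal_mul k.coe_nonneg, ENNReal.ofReal_le_one, norm_inv,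
        Real.norm_of_nonneg hε.le, mul_left_comm, inv_mul_le_iff₀ hε, mul_one]
    rw [OrliczSpace.norm_def]
    refine le_antisymm (le_of_forall_pos_le_add fun ε hε => ?_) ?_
    · exact csInf_le (φ.bddBelow_luxemburgSet _) ((hmem _).2 ⟨by positivity, by linarith⟩)
    · exact le_csInf (OrliczSpace.luxemburgSet_nonempty f) fun ε hε => ((hmem _).1 hε).2

end OrliczFunction

/-- If the norm of `L_φ` is `k` times that of `L¹`, then multiplication by `k` is an isometry. -/
theorem OrliczSpace.EqL1With.nonempty_linearIsometryEquiv {Ω : Type*} [MeasurableSpace Ω]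
    {φ : OrliczFunction} {μ : Measure Ω} {k : ℝ} (hk : 0 < k) (h : OrliczSpace.EqL1With φ μ k) :
    Nonempty (OrliczSpace φ μ ≃ₗᵢ[ℝ] Lp ℝ 1 μ) := by
  have hmul : ∀ f : OrliczSpace φ μ, (k • f : OrliczSpace φ μ).1 ∈ Lp ℝ 1 μ :=
    fun f => (h.1 _).1 (k • f).2
  have hmem : ∀ g : Lp ℝ 1 μ, (g : Ω →ₘ[μ] ℝ) ∈ OrliczSpace φ μ := fun g => (h.1 _).2 g.2
  let e : OrliczSpace φ μ ≃ₗ[ℝ] Lp ℝ 1 μ :=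
    { toFun := fun f => ⟨(k • f : OrliczSpace φ μ).1, hmul f⟩
      map_add' := fun f g => Subtype.ext (smul_add k (f : Ω →ₘ[μ] ℝ) g)
      map_smul' := fun c f => Subtype.ext (smul_comm k c (f : Ω →ₘ[μ] ℝ))
      invFun := fun g => k⁻¹ • ⟨(g : Ω →ₘ[μ] ℝ), hmem g⟩
      left_inv := fun f => Subtype.ext (inv_smul_smul₀ hk.ne' (f : Ω →ₘ[μ] ℝ))
      right_inv := fun g => Subtype.ext (smul_inv_smul₀ hk.ne' (g : Ω →ₘ[μ] ℝ)) }
  refine ⟨⟨e, fun f => ?_⟩⟩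
  have h1 := h.2 (k • f) (e f) rfl
  rw [norm_smul, Real.norm_of_nonneg hk.le] at h1
  exact (mul_left_cancel₀ hk.ne' h1).symm

/-! ### A geometric obstruction to the Daugavet property -/

/-- A point `x` of the unit sphere such that `x + y` or `x - y` is uniformly short for all `y` of
the open unit ball is an obstruction to the Daugavet property. -/
theorem DaugavetProperty.false_of_uniformly_non_square {X : Type*} [NormedAddCommGroup X]
    [NormedSpace ℝ X] (hX : DaugavetProperty X) {x : X} (hx : ‖x‖ = 1) {r : ℝ} (hr1 : 1 ≤ r)
    (hr2 : r < 2) (h : ∀ y : X, ‖y‖ < 1 → ‖x + y‖ ≤ r ∨ ‖x - y‖ ≤ r) : False := by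
  have hx0 : x ≠ 0 := by
    rintro rfl
    simp at hx
  obtain ⟨p, hp, hpx⟩ := exists_dual_vector ℝ x (norm_ne_zero_iff.2 hx0)
  have hpx1 : p x = 1 := by simpa [hx] using hpx
  set T : X →L[ℝ] X := -(p.smulRight x) with hT
  have hTn : ‖T‖ = 1 := by
    rw [hT, norm_neg, ContinuousLinearMap.norm_smulRight_apply, hp, hx, mul_one]
  have hrank : Module.finrank ℝ (T : X →ₗ[ℝ] X).range = 1 := by
    have : (T : X →ₗ[ℝ] X).range = ℝ ∙ x := by
      ext z
      rw [Submodule.mem_span_singleton]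
      constructor
      · rintro ⟨w, rfl⟩
        exact ⟨-(p w), by simp [hT]⟩
      · rintro ⟨c, rfl⟩
        exact ⟨-(c • x), by simp [hT, hpx1]⟩
    rw [this, finrank_span_singleton hx0]
  have hD := hX T hrank
  rw [hTn] at hD
  have hpos : ∀ y : X, ‖y‖ < 1 → 0 ≤ p y → ‖y - p y • x‖ ≤ r := by
    intro y hy hpy
    have hpy1 : p y ≤ 1 := by
      have := p.le_opNorm y
      rw [hp, one_mul] at this
      exact (le_abs_self _).trans (this.trans hy.le)
    -- If `x + y` is short, applying `p` gives `1 + p y ≤ r`, and the triangle inequality suffices.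
    -- If `x - y` is short, `y - p y • x` is a convex combination of `y - x` and `y`.
    rcases h y hy with h1 | h1
    · have h2 : p (x + y) ≤ ‖x + y‖ := by
        have := p.le_opNorm (x + y)
        rw [hp, one_mul] at this
        exact (le_abs_self _).trans this
      rw [map_add, hpx1] at h2
      calc ‖y - p y • x‖ ≤ ‖y‖ + ‖p y • x‖ := norm_sub_le _ _
        _ = ‖y‖ + p y := by rw [norm_smul, hx, mul_one, Real.norm_of_nonneg hpy]
        _ ≤ r := by linarith
    · have e : y - p y • x = p y • (y - x) + (1 - p y) • y := by
        rw [smul_sub, sub_smul, one_smul]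
        abel
      rw [e]
      calc ‖p y • (y - x) + (1 - p y) • y‖ ≤ ‖p y • (y - x)‖ + ‖(1 - p y) • y‖ := norm_add_le _ _
        _ = p y * ‖x - y‖ + (1 - p y) * ‖y‖ := by
          rw [norm_smul, norm_smul, Real.norm_of_nonneg hpy,
            Real.norm_of_nonneg (sub_nonneg.2 hpy1), norm_sub_rev]
        _ ≤ p y * r + (1 - p y) * r := by
          have : 0 ≤ 1 - p y := sub_nonneg.2 hpy1
          gcongr
          linarith
        _ = r := by ring
  have hle : ‖ContinuousLinearMap.id ℝ X + T‖ ≤ r := by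
    rw [← ContinuousLinearMap.sSup_unit_ball_eq_norm]
    refine csSup_le ((Metric.nonempty_ball.2 one_pos).image _) ?_
    rintro _ ⟨y, hy, rfl⟩
    rw [mem_ball_zero_iff] at hy
    have e : ∀ y, (ContinuousLinearMap.id ℝ X + T) y = y - p y • x := by
      intro y
      simp [hT, sub_eq_add_neg]
    rcases le_total 0 (p y) with h0 | h0
    · simpa only [e] using hpos y hy h0
    · have := hpos (-y) (by rwa [norm_neg]) (by rw [map_neg]; linarith)
      rw [← e, map_neg, norm_neg] at this
      exact this
  linarith

/-! ### Convexity estimates for finite Orlicz functions -/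

namespace OrliczFunction

/-- The even extension of an Orlicz function to the real line, with real values. -/
noncomputable def evenExt (φ : OrliczFunction) (u : ℝ) : ℝ := (φ ‖u‖₊).toReal

theorem evenExt_nonneg (φ : OrliczFunction) (u : ℝ) : 0 ≤ φ.evenExt u := ENNReal.toReal_nonneg

theorem evenExt_zero (φ : OrliczFunction) : φ.evenExt 0 = 0 := by simp [evenExt, φ.map_zero]

theorem evenExt_neg (φ : OrliczFunction) (u : ℝ) : φ.evenExt (-u) = φ.evenExt u := by
  simp [evenExt]

theorem IsFinite.ofReal_evenExt {φ : OrliczFunction} (hφ : φ.IsFinite) (u : ℝ) :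
    ENNReal.ofReal (φ.evenExt u) = φ ‖u‖₊ := ENNReal.ofReal_toReal (hφ _)

theorem IsFinite.evenExt_mono {φ : OrliczFunction} (hφ : φ.IsFinite) {u v : ℝ} (h : |u| ≤ |v|) :
    φ.evenExt u ≤ φ.evenExt v :=
  ENNReal.toReal_mono (hφ _) (φ.mono h)

theorem IsFinite.convexOn_evenExt {φ : OrliczFunction} (hφ : φ.IsFinite) :
    ConvexOn ℝ Set.univ φ.evenExt := by
  refine ⟨convex_univ, fun u _ v _ a b ha hb hab => ?_⟩
  lift a to ℝ≥0 using ha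
  lift b to ℝ≥0 using hb
  have hab' : a + b = 1 := by exact_mod_cast hab
  have h := φ.convexOn.2 (Set.mem_univ ‖u‖₊) (Set.mem_univ ‖v‖₊) (zero_le : 0 ≤ a)
    (zero_le : 0 ≤ b) hab'
  have h1 : φ ‖(a : ℝ) • u + (b : ℝ) • v‖₊ ≤ a * φ ‖u‖₊ + b * φ ‖v‖₊ := by
    refine (φ.mono ((nnnorm_add_le _ _).trans_eq ?_)).trans h
    simp
  have h2 := ENNReal.toReal_mono (ENNReal.add_ne_top.2
    ⟨ENNReal.mul_ne_top ENNReal.coe_ne_top (hφ _), ENNReal.mul_ne_top ENNReal.coe_ne_top (hφ _)⟩) h1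
  rw [ENNReal.toReal_add (ENNReal.mul_ne_top ENNReal.coe_ne_top (hφ _))
    (ENNReal.mul_ne_top ENNReal.coe_ne_top (hφ _)), ENNReal.toReal_mul, ENNReal.toReal_mul] at h2
  exact h2

theorem IsFinite.continuous_evenExt {φ : OrliczFunction} (hφ : φ.IsFinite) :
    Continuous φ.evenExt :=
  continuousOn_univ.1 (hφ.convexOn_evenExt.continuousOn isOpen_univ)

theorem IsFinite.evenExt_convex {φ : OrliczFunction} (hφ : φ.IsFinite) {c : ℝ} (hc0 : 0 ≤ c)
    (hc1 : c ≤ 1) (u v : ℝ) :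
    φ.evenExt (c * u + (1 - c) * v) ≤ c * φ.evenExt u + (1 - c) * φ.evenExt v :=
  hφ.convexOn_evenExt.2 (Set.mem_univ u) (Set.mem_univ v) hc0 (sub_nonneg.2 hc1) (by ring)

theorem IsFinite.evenExt_mul_le {φ : OrliczFunction} (hφ : φ.IsFinite) {c : ℝ} (hc0 : 0 ≤ c)
    (hc1 : c ≤ 1) (u : ℝ) : φ.evenExt (c * u) ≤ c * φ.evenExt u := by
  have h := hφ.evenExt_convex hc0 hc1 u 0
  rwa [φ.evenExt_zero, mul_zero, add_zero, add_zero] at h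

/-- A convex function which is not strictly below its chord from `0` at a midpoint is linear up to
the right endpoint. -/
theorem IsFinite.evenExt_eq_of_half_le {φ : OrliczFunction} (hφ : φ.IsFinite) {a u : ℝ}
    (ha : 0 < a) (h : φ.evenExt a / 2 ≤ φ.evenExt (a / 2)) (hu : 0 ≤ u) (hua : u ≤ a) :
    φ.evenExt u = u / a * φ.evenExt a := by
  have h1 := hφ.evenExt_mul_le (div_nonneg hu ha.le) ((div_le_one ha).2 hua) a
  have h2 := hφ.evenExt_mul_le (div_nonneg (sub_nonneg.2 hua) ha.le)
    ((div_le_one ha).2 (sub_le_self a hu)) a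
  -- The points `u` and `a - u` have midpoint `a / 2`, so strictness of either chord bound would
  -- contradict `h`.
  have h3 := hφ.evenExt_convex (c := 1 / 2) (by norm_num) (by norm_num) u (a - u)
  rw [div_mul_cancel₀ _ ha.ne'] at h1 h2
  rw [show 1 / 2 * u + (1 - 1 / 2) * (a - u) = a / 2 by ring] at h3
  have h4 : (a - u) / a * φ.evenExt a = φ.evenExt a - u / a * φ.evenExt a := by
    field_simp
  linarith

/-- A finite Orlicz function which is not linear is eventually strictly below its chords from `0`
at their midpoints. -/
theorem IsFinite.exists_evenExt_half_lt {φ : OrliczFunction} (hφ : φ.IsFinite)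
    (h : ¬φ.IsLinear) : ∃ b > 0, ∀ a ≥ b, φ.evenExt (a / 2) < φ.evenExt a / 2 := by
  by_contra! hc
  apply h
  have hlin : ∀ u : ℝ≥0, φ u = φ 1 * u := by
    intro u
    -- Taking `a` beyond both `u` and `1` puts them on one linear piece, so the slope is always `φ
    -- 1`.
    obtain ⟨a, ha, hle⟩ := hc (max (u : ℝ) 1) (by positivity)
    have ha1 : 1 ≤ a := (le_max_right _ _).trans ha
    have hau : (u : ℝ) ≤ a := (le_max_left _ _).trans ha
    have ha0 : 0 < a := by linarith
    have e1 := hφ.evenExt_eq_of_half_le ha0 hle u.coe_nonneg hau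
    have e2 := hφ.evenExt_eq_of_half_le ha0 hle zero_le_one ha1
    have e3 : φ.evenExt u = φ.evenExt 1 * u := by
      rw [e1, e2]
      ring
    simp only [evenExt, NNReal.nnnorm_eq, nnnorm_one] at e3
    rw [← ENNReal.toReal_eq_toReal_iff' (hφ _) (ENNReal.mul_ne_top (hφ _) ENNReal.coe_ne_top), e3,
      ENNReal.toReal_mul, ENNReal.coe_toReal]
  refine ⟨(φ 1).toNNReal, ?_, fun u => ?_⟩
  · refine ENNReal.toNNReal_pos (fun h0 => ?_) (hφ _)
    obtain ⟨u, -, hu⟩ := φ.exists_ne_zero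
    exact hu (by rw [hlin u, h0, zero_mul])
  · rw [ENNReal.coe_toNNReal (hφ _)]
    exact hlin u

/-- If `φ` is strictly below its chord at `a / 2`, then it satisfies a quantitative parallelogram
inequality which is uniform in the second variable. -/
theorem IsFinite.exists_evenExt_add_sub_le {φ : OrliczFunction} (hφ : φ.IsFinite) {a : ℝ}
    (ha : 0 < a) (hlt : φ.evenExt (a / 2) < φ.evenExt a / 2) :
    ∃ η > 0, ∀ κ > 0, ∃ δ > 0, δ ≤ 1 ∧ δ ≤ κ ∧ ∀ s : ℝ,
      φ.evenExt ((1 + δ) / 2 * (a + s)) + φ.evenExt ((1 + δ) / 2 * (a - s)) + η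
        ≤ φ.evenExt a + (1 + κ) * φ.evenExt s := by
  set p := φ.evenExt with hp
  have hp0 : ∀ u, 0 ≤ p u := φ.evenExt_nonneg
  refine ⟨(p a / 2 - p (a / 2)) / 2, by linarith, fun κ hκ => ?_⟩
  set η₀ := p a / 2 - p (a / 2) with hη₀
  have hη₀pos : 0 < η₀ := by linarith
  set C := p (4 * a) with hC
  have hC0 : 0 ≤ C := hp0 _
  -- The bounds serve in turn to keep `1/2 - δ ≥ 0`, to absorb the dilation into `κ p s`, and to
  -- make its cost `2 δ C` at most half the midpoint gap `η₀`.
  set δ := min (min (1 / 2) (κ / 2)) (η₀ / (4 * (C + 1))) with hδ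
  have hδ0 : 0 < δ := by positivity
  have hδ1 : δ ≤ 1 / 2 := (min_le_left _ _).trans (min_le_left _ _)
  have hδκ : δ ≤ κ / 2 := (min_le_left _ _).trans (min_le_right _ _)
  have hδC : 2 * δ * C ≤ η₀ / 2 := by
    have h1 : δ ≤ η₀ / (4 * (C + 1)) := min_le_right _ _
    rw [le_div_iff₀ (by positivity)] at h1
    linarith
  refine ⟨δ, hδ0, by linarith, by linarith, ?_⟩
  have main : ∀ s, 0 ≤ s → p ((1 + δ) / 2 * (a + s)) + p ((1 + δ) / 2 * (a - s)) + η₀ / 2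
      ≤ p a + (1 + κ) * p s := by
    intro s hs
    have hκs : 2 * δ * p s ≤ κ * p s := mul_le_mul_of_nonneg_right (by linarith) (hp0 s)
    -- For `s ≤ 3a` the points `(a ± s)/2` stay in `[-2a, 2a]`, where dilation by `1 + δ` costs at
    -- most `δ C`. For `s ≥ 3a`, exactly the range where `(1+δ)/2 (a+s) ≤ (1/2-δ) a + (1/2+δ) s`,
    -- convexity with these weights leaves at least `p a / 2` to spare.
    rcases le_total s (3 * a) with hs3 | hs3
    · have step : ∀ v, |v| ≤ 2 * a → p ((1 + δ) * v) ≤ p v + δ * C := by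
        intro v hv
        have h1 := hφ.evenExt_convex hδ0.le (by linarith) (2 * v) v
        rw [show δ * (2 * v) + (1 - δ) * v = (1 + δ) * v by ring] at h1
        have h2 : p (2 * v) ≤ C := hφ.evenExt_mono (by
          rw [abs_mul, abs_two, abs_of_pos (by positivity : 0 < 4 * a)]
          linarith)
        have h3 := mul_le_mul_of_nonneg_left h2 hδ0.le
        have h4 := mul_nonneg hδ0.le (hp0 v)
        linarith
      have h1 := step ((a + s) / 2) (by rw [abs_le]; constructor <;> linarith)
      have h2 := step ((a - s) / 2) (by rw [abs_le]; constructor <;> linarith)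
      rw [show (1 + δ) * ((a + s) / 2) = (1 + δ) / 2 * (a + s) by ring] at h1
      rw [show (1 + δ) * ((a - s) / 2) = (1 + δ) / 2 * (a - s) by ring] at h2
      have h3 : p ((a + s) / 2) ≤ p a / 2 + p s / 2 := by
        have := hφ.evenExt_convex (c := 1 / 2) (by norm_num) (by norm_num) a s
        rw [show 1 / 2 * a + (1 - 1 / 2) * s = (a + s) / 2 by ring] at this
        linarith
      have h4 : p ((a - s) / 2) ≤ p a / 2 + p s / 2 - η₀ := by
        rcases le_total s a with hsa | hsa
        · have : p ((a - s) / 2) ≤ p (a / 2) := hφ.evenExt_mono (by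
            rw [abs_of_nonneg (by linarith), abs_of_nonneg (by linarith)]
            linarith)
          have := hp0 s
          linarith
        · have h5 : p ((a - s) / 2) ≤ p (1 / 2 * s) := hφ.evenExt_mono (by
            rw [abs_of_nonpos (by linarith), abs_of_nonneg (by linarith)]
            linarith)
          have h6 := hφ.evenExt_mul_le (c := 1 / 2) (by norm_num) (by norm_num) s
          have := hp0 (a / 2)
          linarith
      have := mul_nonneg hκ.le (hp0 s)
      linarith
    · have h1 : p ((1 + δ) / 2 * (a + s)) ≤ (1 / 2 - δ) * p a + (1 / 2 + δ) * p s := by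
        have h := hφ.evenExt_convex (c := 1 / 2 - δ) (by linarith) (by linarith) a s
        rw [show 1 - (1 / 2 - δ) = 1 / 2 + δ by ring] at h
        refine le_trans (hφ.evenExt_mono ?_) h
        have hδs : 0 ≤ δ * (s - 3 * a) := mul_nonneg hδ0.le (by linarith)
        have h0 : 0 ≤ (1 + δ) / 2 * (a + s) := by positivity
        have h01 : (1 + δ) / 2 * (a + s) ≤ (1 / 2 - δ) * a + (1 / 2 + δ) * s := by linarith
        rw [abs_of_nonneg h0, abs_of_nonneg (h0.trans h01)]
        exact h01
      have h2 : p ((1 + δ) / 2 * (a - s)) ≤ (1 + δ) / 2 * p s := by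
        refine le_trans (hφ.evenExt_mono ?_)
          (hφ.evenExt_mul_le (c := (1 + δ) / 2) (by linarith) (by linarith) s)
        rw [abs_mul, abs_mul]
        refine mul_le_mul_of_nonneg_left ?_ (abs_nonneg _)
        rw [abs_of_nonpos (by linarith), abs_of_nonneg hs]
        linarith
      have h3 := mul_nonneg hδ0.le (hp0 a)
      have h4 := mul_nonneg hδ0.le (hp0 s)
      have h5 := hp0 (a / 2)
      linarith
  intro s
  rcases le_total 0 s with hs | hs
  · exact main s hs
  · have h := main (-s) (by linarith)
    rw [hp, φ.evenExt_neg s, ← hp, sub_neg_eq_add, ← sub_eq_add_neg] at h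
    linarith

/-- Convexity gives `φ (n |b|) ≥ n φ b`, so the values are unbounded and the intermediate value
theorem applies beyond `b`. -/
theorem IsFinite.exists_evenExt_eq {φ : OrliczFunction} (hφ : φ.IsFinite) {b : ℝ}
    (hb : 0 < φ.evenExt b) {M : ℝ} (hM : φ.evenExt b ≤ M) : ∃ a ≥ b, φ.evenExt a = M := by
  have hb0 : b ≠ 0 := fun h => hb.ne' (h ▸ φ.evenExt_zero)
  obtain ⟨n, hn⟩ := exists_nat_gt (M / φ.evenExt b)
  rw [div_lt_iff₀ hb] at hn
  have hn1 : (1 : ℝ) ≤ n := by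
    by_contra! h
    have := mul_lt_mul_of_pos_right h hb
    linarith
  have hle : M ≤ φ.evenExt (n * |b|) := by
    have h := hφ.evenExt_mul_le (c := (n : ℝ)⁻¹) (by positivity) (inv_le_one_of_one_le₀ hn1)
      (n * |b|)
    rw [inv_mul_cancel_left₀ (by positivity), ← div_eq_inv_mul, le_div_iff₀ (by positivity)] at h
    have e : φ.evenExt |b| = φ.evenExt b := by simp [evenExt]
    rw [e] at h
    linarith
  have hbn : b ≤ n * |b| := (le_abs_self b).trans (le_mul_of_one_le_left (abs_nonneg b) hn1)
  obtain ⟨a, ha, hMa⟩ := intermediate_value_Icc hbn hφ.continuous_evenExt.continuousOn ⟨hM, hle⟩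
  exact ⟨a, ha.1, hMa⟩

theorem IsFinite.modular_smul_eq {Ω : Type*} [MeasurableSpace Ω] {μ : Measure Ω}
    {φ : OrliczFunction} (hφ : φ.IsFinite) (c : ℝ) (f : Ω →ₘ[μ] ℝ) :
    φ.modular (c • f) = ∫⁻ t, ENNReal.ofReal (φ.evenExt (c * f t)) ∂μ := by
  rw [φ.modular_smul]
  refine lintegral_congr fun t => ?_
  rw [hφ.ofReal_evenExt, nnnorm_mul]

/-- The modular of a multiple of the indicator of a set. -/
theorem IsFinite.modular_smul_mk_indicator {Ω : Type*} [MeasurableSpace Ω] {μ : Measure Ω}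
    {φ : OrliczFunction} (hφ : φ.IsFinite) {A : Set Ω} (hA : MeasurableSet A) (a c : ℝ)
    (hm : AEStronglyMeasurable (A.indicator fun _ => a) μ) :
    φ.modular (c • AEEqFun.mk _ hm) = ENNReal.ofReal (φ.evenExt (c * a)) * μ A := by
  rw [hφ.modular_smul_eq, ← lintegral_indicator_const hA]
  refine lintegral_congr_ae ?_
  filter_upwards [AEEqFun.coeFn_mk _ hm] with t ht
  rw [ht]
  by_cases h : t ∈ A
  · simp [h]
  · simp [h, φ.evenExt_zero]

end OrliczFunction

/-! ### The Daugavet property forces linearity -/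

/-- A finite Orlicz function whose Orlicz space has the Daugavet property is linear. -/
theorem OrliczFunction.IsFinite.isLinear_of_daugavetProperty {Ω : Type*} [MeasurableSpace Ω]
    {μ : Measure Ω} [SigmaFinite μ] (hμ0 : μ ≠ 0) (hμ : IsNonatomic μ) {φ : OrliczFunction}
    (hφ : φ.IsFinite) (hD : DaugavetProperty (OrliczSpace φ μ)) : φ.IsLinear := by
  by_contra hlin
  obtain ⟨b, hb0, hb⟩ := hφ.exists_evenExt_half_lt hlin
  have hpb : 0 < φ.evenExt b := by
    have := hb b le_rfl
    have := φ.evenExt_nonneg (b / 2)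
    linarith
  obtain ⟨n, hn⟩ : ∃ n, 0 < μ (spanningSets μ n) := by
    by_contra! h
    refine hμ0 (Measure.measure_univ_eq_zero.1 ?_)
    rw [← iUnion_spanningSets μ]
    exact measure_iUnion_null fun n => le_antisymm (h n) zero_le
  have : IsFiniteMeasure (μ.restrict (spanningSets μ n)) :=
    ⟨by simpa using measure_spanningSets_lt_top μ n⟩
  -- The bound `μ A ≤ 1 / φ b` makes the solution of `φ a = 1 / μ A` available with `a ≥ b`, where
  -- the midpoint inequality is strict.
  obtain ⟨A, hAs, hA, hA0, hAle⟩ := hμ.exists_subset_measure_le (μ.restrict (spanningSets μ n))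
    (measurableSet_spanningSets μ n) hn (show 0 < (φ.evenExt b)⁻¹ by positivity)
  rw [Measure.real, Measure.restrict_eq_self _ hAs] at hAle
  have hAtop : μ A ≠ ∞ := ((measure_mono hAs).trans_lt (measure_spanningSets_lt_top μ n)).ne
  set m := (μ A).toReal with hm
  have hm0 : 0 < m := ENNReal.toReal_pos hA0.ne' hAtop
  have hμA : μ A = ENNReal.ofReal m := (ENNReal.ofReal_toReal hAtop).symm
  obtain ⟨a, hab, hpa⟩ := hφ.exists_evenExt_eq hpb ((le_inv_comm₀ hm0 hpb).1 hAle)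
  have ha0 : 0 < a := hb0.trans_le hab
  obtain ⟨η, hη, hpar⟩ := hφ.exists_evenExt_add_sub_le ha0 (hb a hab)
  -- With `κ = η m` the excess `κ ∫ φ(|y|) ≤ η m` is exactly paid for by the gain `η` on `A`.
  obtain ⟨δ, hδ0, hδ1, hδκ, hpar⟩ := hpar (η * m) (by positivity)
  have hmeas : AEStronglyMeasurable (A.indicator fun _ => a) μ :=
    (stronglyMeasurable_const.indicator hA).aestronglyMeasurable
  set x₀ : Ω →ₘ[μ] ℝ := AEEqFun.mk _ hmeas with hx₀
  have hmod : ∀ c : ℝ, φ.modular (c • x₀) = ENNReal.ofReal (φ.evenExt (c * a) * m) := by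
    intro c
    rw [hφ.modular_smul_mk_indicator hA, hμA, ← ENNReal.ofReal_mul (φ.evenExt_nonneg _)]
  have hx1 : (1 : ℝ) ∈ φ.luxemburgSet x₀ := by
    refine ⟨one_pos, ?_⟩
    rw [hmod, inv_one, one_mul, hpa, inv_mul_cancel₀ hm0.ne', ENNReal.ofReal_one]
  set x : OrliczSpace φ μ := ⟨x₀, (φ.luxemburgSet_nonempty_iff _).1 ⟨1, hx1⟩⟩ with hx
  have hxn : ‖x‖ = 1 := by
    refine le_antisymm (csInf_le (φ.bddBelow_luxemburgSet _) hx1)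
      (le_csInf ⟨1, hx1⟩ fun ε hε => ?_)
    obtain ⟨hε0, hε1⟩ := hε
    by_contra! hlt
    rw [hmod, ENNReal.ofReal_le_one] at hε1
    have h := hφ.evenExt_mul_le hε0.le hlt.le (ε⁻¹ * a)
    rw [mul_inv_cancel_left₀ hε0.ne', hpa] at h
    have h2 := mul_le_mul_of_nonneg_right h hm0.le
    rw [inv_mul_cancel₀ hm0.ne', mul_assoc] at h2
    have h3 := mul_le_mul_of_nonneg_left hε1 hε0.le
    linarith
  set c := (1 + δ) / 2 with hc
  have hc0 : 0 < c := by positivity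
  refine hD.false_of_uniformly_non_square hxn (r := c⁻¹)
    ((one_le_inv₀ hc0).2 (by linarith)) ((inv_lt_comm₀ hc0 two_pos).2 (by linarith)) ?_
  intro y hy
  have hyI : φ.modular (y : Ω →ₘ[μ] ℝ) ≤ 1 := by
    obtain ⟨ε, hε, hε1⟩ := exists_lt_of_csInf_lt (OrliczSpace.luxemburgSet_nonempty y)
      (show sInf (φ.luxemburgSet (y : Ω →ₘ[μ] ℝ)) < 1 from hy)
    have h := φ.modular_smul_mono (c := 1) (d := ε⁻¹) ?_ (y : Ω →ₘ[μ] ℝ)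
    · rw [one_smul] at h
      exact h.trans hε.2
    · rw [abs_one, abs_of_pos (inv_pos.2 hε.1)]
      exact (one_le_inv₀ hε.1).2 hε1.le
  rw [← one_smul ℝ (y : Ω →ₘ[μ] ℝ), hφ.modular_smul_eq] at hyI
  simp only [one_mul] at hyI
  have hpt : ∀ᵐ t ∂μ, φ.evenExt (c * (x₀ + y : Ω →ₘ[μ] ℝ) t)
      + φ.evenExt (c * (x₀ - y : Ω →ₘ[μ] ℝ) t) + A.indicator (fun _ => η) t
      ≤ A.indicator (fun _ => m⁻¹) t + (1 + η * m) * φ.evenExt ((y : Ω →ₘ[μ] ℝ) t) := by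
    filter_upwards [AEEqFun.coeFn_mk _ hmeas, AEEqFun.coeFn_add x₀ (y : Ω →ₘ[μ] ℝ),
      AEEqFun.coeFn_sub x₀ (y : Ω →ₘ[μ] ℝ)] with t h1 h2 h3
    rw [h2, h3, Pi.add_apply, Pi.sub_apply, hx₀, h1]
    by_cases ht : t ∈ A
    · simp only [Set.indicator_of_mem ht, ← hpa]
      exact hpar _
    · simp only [Set.indicator_of_notMem ht, zero_add, zero_sub, add_zero]
      -- Off `A` both terms equal `φ(c|y|) ≤ c φ(|y|)`, and `2c = 1 + δ ≤ 1 + η m`.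
      rw [mul_neg, φ.evenExt_neg]
      have h4 := hφ.evenExt_mul_le hc0.le (by linarith) ((y : Ω →ₘ[μ] ℝ) t)
      have h5 : 2 * c * φ.evenExt ((y : Ω →ₘ[μ] ℝ) t)
          ≤ (1 + η * m) * φ.evenExt ((y : Ω →ₘ[μ] ℝ) t) :=
        mul_le_mul_of_nonneg_right (by linarith) (φ.evenExt_nonneg _)
      linarith
  have hcm : ∀ f : Ω →ₘ[μ] ℝ, ∀ d : ℝ,
      AEMeasurable (fun t => ENNReal.ofReal (φ.evenExt (d * f t))) μ := fun f d =>
    (hφ.continuous_evenExt.measurable.comp_aemeasurable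
      (f.aestronglyMeasurable.aemeasurable.const_mul d)).ennreal_ofReal
  have hsum : φ.modular (c • (x₀ + y : Ω →ₘ[μ] ℝ)) + φ.modular (c • (x₀ - y : Ω →ₘ[μ] ℝ))
      + ENNReal.ofReal (η * m) ≤ 1 + ENNReal.ofReal (1 + η * m) := by
    rw [hφ.modular_smul_eq, hφ.modular_smul_eq]
    calc _ = ∫⁻ t, (ENNReal.ofReal (φ.evenExt (c * (x₀ + y : Ω →ₘ[μ] ℝ) t))
          + ENNReal.ofReal (φ.evenExt (c * (x₀ - y : Ω →ₘ[μ] ℝ) t))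
          + A.indicator (fun _ => ENNReal.ofReal η) t) ∂μ := by
          rw [lintegral_add_right _ (measurable_const.indicator hA),
            lintegral_add_left' (hcm _ _), lintegral_indicator_const hA, hμA,
            ENNReal.ofReal_mul hη.le]
      _ ≤ ∫⁻ t, (A.indicator (fun _ => ENNReal.ofReal m⁻¹) t + ENNReal.ofReal (1 + η * m)
          * ENNReal.ofReal (φ.evenExt ((y : Ω →ₘ[μ] ℝ) t))) ∂μ := by
          refine lintegral_mono_ae ?_
          filter_upwards [hpt] with t ht
          have hind : ∀ d : ℝ, A.indicator (fun _ => ENNReal.ofReal d) t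
              = ENNReal.ofReal (A.indicator (fun _ => d) t) := by
            intro d
            by_cases h : t ∈ A <;> simp [h]
          have hindη : 0 ≤ A.indicator (fun _ => η) t := Set.indicator_nonneg (fun _ _ => hη.le) t
          have hindm : 0 ≤ A.indicator (fun _ => m⁻¹) t :=
            Set.indicator_nonneg (fun _ _ => (inv_pos.2 hm0).le) t
          rw [hind, hind, ← ENNReal.ofReal_add (φ.evenExt_nonneg _) (φ.evenExt_nonneg _),
            ← ENNReal.ofReal_add (add_nonneg (φ.evenExt_nonneg _) (φ.evenExt_nonneg _)) hindη,
            ← ENNReal.ofReal_mul (by positivity), ← ENNReal.ofReal_add hindm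
              (mul_nonneg (by positivity) (φ.evenExt_nonneg _))]
          exact ENNReal.ofReal_le_ofReal ht
      _ ≤ 1 + ENNReal.ofReal (1 + η * m) := by
          rw [lintegral_add_left (measurable_const.indicator hA), lintegral_indicator_const hA,
            lintegral_const_mul' _ _ ENNReal.ofReal_ne_top, hμA,
            ← ENNReal.ofReal_mul (inv_pos.2 hm0).le, inv_mul_cancel₀ hm0.ne', ENNReal.ofReal_one]
          gcongr
          exact mul_le_of_le_one_right zero_le hyI
  have hsum2 : φ.modular (c • (x₀ + y : Ω →ₘ[μ] ℝ)) + φ.modular (c • (x₀ - y : Ω →ₘ[μ] ℝ))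
      ≤ 1 + 1 := by
    rw [ENNReal.ofReal_add zero_le_one (by positivity), ENNReal.ofReal_one, ← add_assoc] at hsum
    exact (ENNReal.add_le_add_iff_right ENNReal.ofReal_ne_top).1 hsum
  have hnorm : ∀ z : OrliczSpace φ μ, φ.modular (c • (z : Ω →ₘ[μ] ℝ)) ≤ 1 → ‖z‖ ≤ c⁻¹ :=
    fun z hz => csInf_le (φ.bddBelow_luxemburgSet _) ⟨inv_pos.2 hc0, by rwa [inv_inv]⟩
  -- Two modulars with sum at most 2 cannot both exceed 1.
  by_cases h1 : φ.modular (c • (x₀ + y : Ω →ₘ[μ] ℝ)) ≤ 1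
  · exact Or.inl (hnorm (x + y) h1)
  · refine Or.inr (hnorm (x - y) ?_)
    by_contra! h2
    exact (ENNReal.add_lt_add (not_le.1 h1) h2).not_ge hsum2

theorem mainTheorem5 {Ω : Type*} [MeasurableSpace Ω] (μ : Measure Ω) [SigmaFinite μ]
    (hμ0 : μ ≠ 0) (hμ : IsNonatomic μ) (φ : OrliczFunction) (hφ : φ.IsFinite) :
    [DaugavetProperty (OrliczSpace φ μ),
      φ.IsLinear,
      ∃ k : ℝ, 0 < k ∧ OrliczSpace.EqL1With φ μ k,
      Nonempty (OrliczSpace φ μ ≃ₗᵢ[ℝ] Lp ℝ 1 μ)].TFAE ∧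
    ∀ k : ℝ≥0, 0 < k → φ.IsLinearWith k → OrliczSpace.EqL1With φ μ k := by
  refine ⟨?_, fun k hk h => h.eqL1With hk⟩
  tfae_have 1 → 2 := fun h => hφ.isLinear_of_daugavetProperty hμ0 hμ h
  tfae_have 2 → 3 := fun ⟨k, hk, h⟩ => ⟨k, hk, h.eqL1With hk⟩
  tfae_have 3 → 4 := fun ⟨_, hk, h⟩ => h.nonempty_linearIsometryEquiv hk
  tfae_have 4 → 1 := fun ⟨e⟩ => hμ.daugavetProperty_lp_one.of_linearIsometryEquiv e
  tfae_finish
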